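/- Let $K$ be an algebraically closed field of characteristic zero and $R=K[x_1,\dots,x_n]$. Let $h=(h_1,\dots,h_n)\neq 0$ be a vector of homogeneous polynomials $h_j\in R$ of the same degree which is self-vanishing, that is, $\sum_{k=1}^n h_k\,\partial h_j/\partial x_k=0$ for all $j$. Let $Z:\mathbb P^{n-1}\dashrightarrow\mathbb P^{n-1}$ be the rational map $x\mapsto(h_1(x):\cdots:h_n(x))$, let $W$ be its image (the Zariski closure of the set of its values), let $T\subset\mathbb P^{n-1}$ be the fundamental locus, defined by $h_1(x)=\cdots=h_n(x)=0$, and let $L(W)$ be the smallest projective linear subspace of $\mathbb P^{n-1}$ containing $W$. Assume that $\dim W=1$. (1) If $\gcd(h_1,\dots,h_n)=1$, then $\sum_{k=1}^n \omega_k\,\partial h_j/\partial x_k=0$ for every $j$ and every point $(\omega_1:\cdots:\omega_n)\in L(W)$. (2) With source and target $\mathbb P^{n-1}$ identified by the identity of coordinates, $L(W)\subset T$ (whether or not $\gcd(h_1,\dots,h_n)=1$). -/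

import Mathlib

open scoped LinearAlgebra.Projectivization

noncomputable section

namespace GordanNoether

variable {K : Type*} [Field K] {n : ℕ}

/-- A system of forms: a nonzero vector of `n` homogeneous polynomials of the same degree in
`K[x_1, …, x_n]`. -/
def IsFormSystem (h : Fin n → MvPolynomial (Fin n) K) : Prop :=
  h ≠ 0 ∧ ∃ d : ℕ, ∀ j, (h j).IsHomogeneous d

/-- The differential operator `D_x(h) f = ∑ j, h_j ∂f/∂x_j`. -/
def diffOp (h : Fin n → MvPolynomial (Fin n) K) (f : MvPolynomial (Fin n) K) :
    MvPolynomial (Fin n) K :=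
  ∑ j, h j * MvPolynomial.pderiv j f

/-- The polynomial solutions `f` of `D_x(h) f = 0`. -/
def sol (h : Fin n → MvPolynomial (Fin n) K) : Set (MvPolynomial (Fin n) K) :=
  {f | diffOp h f = 0}

/-- `h` is self-vanishing: every component `h_j` solves `D_x(h) h_j = 0`. -/
def IsSelfVanishing (h : Fin n → MvPolynomial (Fin n) K) : Prop :=
  ∀ j, h j ∈ sol h

/-- `h` is reduced: `GCD(h_1, …, h_n) = 1`, i.e. every common divisor is a unit. -/
def HasTrivialGCD (h : Fin n → MvPolynomial (Fin n) K) : Prop :=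
  ∀ g : MvPolynomial (Fin n) K, (∀ j, g ∣ h j) → IsUnit g

/-- For a set `U` of points of projective space, the polynomials killed by
`∑ j, ω_j ∂/∂x_j` for every point `(ω_1 : ⋯ : ω_n)` of `U`. -/
def solPoints (U : Set (ℙ K (Fin n → K))) : Set (MvPolynomial (Fin n) K) :=
  {f | ∀ P ∈ U, ∀ ω ∈ P.submodule, diffOp (fun j => MvPolynomial.C (ω j)) f = 0}

/-- The common zeros in projective space of a set of (homogeneous) polynomials: the points, i.e.
lines through the origin, on which all of them vanish. -/
def zeroLocus (S : Set (MvPolynomial (Fin n) K)) : Set (ℙ K (Fin n → K)) :=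
  {P | ∀ f ∈ S, ∀ v ∈ P.submodule, MvPolynomial.eval v f = 0}

/-- A projective algebraic set: the zero locus of a set of homogeneous polynomials. -/
def IsAlgebraic (A : Set (ℙ K (Fin n → K))) : Prop :=
  ∃ S : Set (MvPolynomial (Fin n) K), (∀ f ∈ S, ∃ d, f.IsHomogeneous d) ∧ A = zeroLocus S

theorem eval_smul_of_homogeneous {f : MvPolynomial (Fin n) K} {d : ℕ} (hf : f.IsHomogeneous d)
    (c : K) (v : Fin n → K) :
    MvPolynomial.eval (c • v) f = c ^ d * MvPolynomial.eval v f := by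
  rw [MvPolynomial.eval_eq, MvPolynomial.eval_eq, Finset.mul_sum]
  refine Finset.sum_congr rfl fun m hm => ?_
  have hd : ∑ i ∈ m.support, m i = d := by
    have := hf (MvPolynomial.mem_support_iff.mp hm)
    simpa [Finsupp.weight_apply, Finsupp.sum] using this
  simp only [Pi.smul_apply, smul_eq_mul, mul_pow, Finset.prod_mul_distrib]
  rw [Finset.prod_pow_eq_pow_sum, hd]
  ring

theorem vanishes_iff_eval_rep {f : MvPolynomial (Fin n) K} {d : ℕ} (hf : f.IsHomogeneous d)
    (P : ℙ K (Fin n → K)) :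
    (∀ v ∈ P.submodule, MvPolynomial.eval v f = 0) ↔ MvPolynomial.eval P.rep f = 0 := by
  rw [Projectivization.submodule_eq]
  constructor
  · intro H
    exact H _ (Submodule.mem_span_singleton_self _)
  · intro H v hv
    obtain ⟨c, rfl⟩ := Submodule.mem_span_singleton.mp hv
    rw [eval_smul_of_homogeneous hf, H, mul_zero]

theorem isAlgebraic_empty : IsAlgebraic (∅ : Set (ℙ K (Fin n → K))) := by
  refine ⟨{1}, ?_, ?_⟩
  · rintro f rfl
    exact ⟨0, MvPolynomial.isHomogeneous_one _ _⟩
  · ext P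
    simp only [Set.mem_empty_iff_false, false_iff]
    intro H
    simpa using H 1 rfl 0 (Submodule.zero_mem _)

theorem isAlgebraic_sInter (𝒜 : Set (Set (ℙ K (Fin n → K)))) (h𝒜 : ∀ A ∈ 𝒜, IsAlgebraic A) :
    IsAlgebraic (⋂₀ 𝒜) := by
  refine ⟨{f | (∃ d, f.IsHomogeneous d) ∧ ∃ A ∈ 𝒜, ∀ P ∈ A, ∀ v ∈ P.submodule,
    MvPolynomial.eval v f = 0}, fun f hf => hf.1, ?_⟩
  ext P
  constructor
  · rintro H f ⟨-, A, hA, hfA⟩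
    exact hfA P (H A hA)
  · intro H A hA
    obtain ⟨S, hS, rfl⟩ := h𝒜 A hA
    intro f hf
    exact H f ⟨hS f hf, _, hA, fun Q hQ => hQ f hf⟩

theorem isAlgebraic_union (A : Set (ℙ K (Fin n → K))) (hA : IsAlgebraic A)
    (B : Set (ℙ K (Fin n → K))) (hB : IsAlgebraic B) : IsAlgebraic (A ∪ B) := by
  obtain ⟨S, hS, rfl⟩ := hA
  obtain ⟨S', hS', rfl⟩ := hB
  refine ⟨{f | ∃ a ∈ S, ∃ b ∈ S', f = a * b}, ?_, ?_⟩
  · rintro f ⟨a, ha, b, hb, rfl⟩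
    obtain ⟨d, hd⟩ := hS a ha
    obtain ⟨e, he⟩ := hS' b hb
    exact ⟨d + e, hd.mul he⟩
  · ext P
    constructor
    · rintro (H | H) f ⟨a, ha, b, hb, rfl⟩ v hv
      · rw [map_mul, H a ha v hv, zero_mul]
      · rw [map_mul, H b hb v hv, mul_zero]
    · intro H
      by_contra hcon
      simp only [Set.mem_union, not_or, zeroLocus, Set.mem_ofPred_eq] at hcon
      obtain ⟨h1, h2⟩ := hcon
      push Not at h1 h2
      obtain ⟨a, ha, v, hv, hav⟩ := h1
      obtain ⟨b, hb, w, hw, hbw⟩ := h2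
      obtain ⟨d, hd⟩ := hS a ha
      obtain ⟨e, he⟩ := hS' b hb
      have hr := H (a * b) ⟨a, ha, b, hb, rfl⟩ P.rep
        (by rw [Projectivization.submodule_eq]; exact Submodule.mem_span_singleton_self _)
      rw [map_mul, mul_eq_zero] at hr
      rcases hr with hr | hr
      · exact hav ((vanishes_iff_eval_rep hd P).mpr hr v hv)
      · exact hbw ((vanishes_iff_eval_rep he P).mpr hr w hw)

/-- The Zariski topology on projective space: closed sets are the projective algebraic sets. -/
@[reducible] def zariskiTopology (K : Type*) [Field K] (n : ℕ) : TopologicalSpace (ℙ K (Fin n → K)) :=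
  TopologicalSpace.ofClosed {A | IsAlgebraic A} isAlgebraic_empty
    (fun 𝒜 h𝒜 => isAlgebraic_sInter 𝒜 fun _ hA => h𝒜 hA)
    (fun A hA B hB => isAlgebraic_union A hA B hB)

/-- The set of all points `(h_1(x) : ⋯ : h_n(x))`, for `x` outside the common zeros of `h`. -/
def valueSet (h : Fin n → MvPolynomial (Fin n) K) : Set (ℙ K (Fin n → K)) :=
  {Q | ∃ x : Fin n → K, x ≠ 0 ∧ ∃ hx : (fun j => MvPolynomial.eval x (h j)) ≠ 0,
    Q = Projectivization.mk K (fun j => MvPolynomial.eval x (h j)) hx}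

/-- The image `W` of the rational map `Z : ℙⁿ⁻¹ ⇢ ℙⁿ⁻¹`, `x ↦ (h_1(x) : ⋯ : h_n(x))`, as an
algebraic set: the Zariski closure of the set of its values. -/
def image (h : Fin n → MvPolynomial (Fin n) K) : Set (ℙ K (Fin n → K)) :=
  @closure _ (zariskiTopology K n) (valueSet h)

/-- The dimension of a subset of projective space: the Krull dimension of its (induced) Zariski
topology. -/
def dimension (A : Set (ℙ K (Fin n → K))) : WithBot ℕ∞ :=
  letI := zariskiTopology K n
  topologicalKrullDim A

/-- The linear closure `L(U)`: the smallest projective linear subspace containing `U`. -/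
def linearClosure (U : Set (ℙ K (Fin n → K))) : Set (ℙ K (Fin n → K)) :=
  (Projectivization.Subspace.span U : Set (ℙ K (Fin n → K)))

/-- The fundamental locus `T`, defined by the equations `h_1(x) = ⋯ = h_n(x) = 0`. -/
def fundamentalLocus (h : Fin n → MvPolynomial (Fin n) K) : Set (ℙ K (Fin n → K)) :=
  zeroLocus (Set.range h)

end GordanNoether

end

open scoped LinearAlgebra.Projectivization

namespace GordanNoether

open MvPolynomial

variable {K : Type*} [Field K] {n : ℕ}

/-! Write `h_a = ∑ a_i h_i` and let `N` be the space of constant vectors `ω` whose directional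
derivative `D_ω` kills every `h_j`. For trivial gcd the point is that `W` lies in `P(N)`: then so
does `L(W)`, which is (1). Euler's formula at `ω` gives `h_j(ω) = 0`, and dividing by the gcd
reduces (2) to this case.

If `u` is an irreducible factor of `h_a ≠ 0`, the values of `h` on `u = 0` form an irreducible set
inside a hyperplane section of the irreducible curve `W`, hence a single point `ω`
(`exists_direction`), and `h` is a multiple of `ω` modulo `u`. If `v` divides a nonzero `h_c`, then
`D_h v = 0`, because the kernel of `D_h` is factorially closed, so `u` divides `D_ω v`; this forces
`D_ω v = 0` once `deg v ≤ deg u`. Hence factors `u` of maximal degree for generic `a` have `ω ∈ N`.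

If `b` annihilates `N` but `h_b ≠ 0`, all those factors divide `h_b`. A generic `h_a` shares no
irreducible factor with `h_b`, contradicting maximality (`sum_eq_zero_of_forall_killingSubmodule`).
-/

/-! ### The derivation `D_h` and its factorially closed kernel -/

theorem diffOp_add (h : Fin n → MvPolynomial (Fin n) K) (f g : MvPolynomial (Fin n) K) :
    diffOp h (f + g) = diffOp h f + diffOp h g := by
  simp [diffOp, mul_add, Finset.sum_add_distrib]

theorem diffOp_mul (h : Fin n → MvPolynomial (Fin n) K) (f g : MvPolynomial (Fin n) K) :
    diffOp h (f * g) = f * diffOp h g + g * diffOp h f := by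
  simp only [diffOp, Derivation.leibniz, smul_eq_mul, mul_add, Finset.sum_add_distrib,
    Finset.mul_sum]
  congr 1 <;> exact Finset.sum_congr rfl fun j _ => by ring

@[simp]
theorem diffOp_C (h : Fin n → MvPolynomial (Fin n) K) (c : K) : diffOp h (C c) = 0 := by
  simp [diffOp]

@[simp]
theorem diffOp_X (h : Fin n → MvPolynomial (Fin n) K) (i : Fin n) : diffOp h (X i) = h i := by
  simp [diffOp, pderiv_X, Pi.single_apply]

@[simp]
theorem diffOp_zero (h : Fin n → MvPolynomial (Fin n) K) : diffOp h 0 = 0 := by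
  simp [diffOp]

theorem diffOp_sum_C_mul (h : Fin n → MvPolynomial (Fin n) K) (a : Fin n → K)
    (f : Fin n → MvPolynomial (Fin n) K) :
    diffOp h (∑ i, C (a i) * f i) = ∑ i, C (a i) * diffOp h (f i) := by
  simp only [diffOp, map_sum, Finset.mul_sum, pderiv_C_mul]
  rw [Finset.sum_comm]
  exact Finset.sum_congr rfl fun j _ => Finset.sum_congr rfl fun i _ => by ring

/-- The substitution `f(x) ↦ f(x + t h(x))`. -/
noncomputable def shift (h : Fin n → MvPolynomial (Fin n) K) :
    MvPolynomial (Fin n) K →ₐ[K] Polynomial (MvPolynomial (Fin n) K) :=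
  aeval fun i => Polynomial.C (X i) + Polynomial.X * Polynomial.C (h i)

theorem coeff_shift_mul_X_zero (h : Fin n → MvPolynomial (Fin n) K) (p : MvPolynomial (Fin n) K)
    (i : Fin n) : (shift h (p * X i)).coeff 0 = (shift h p).coeff 0 * X i := by
  simp [shift, mul_add]

theorem coeff_shift_mul_X_succ (h : Fin n → MvPolynomial (Fin n) K) (p : MvPolynomial (Fin n) K)
    (i : Fin n) (k : ℕ) : (shift h (p * X i)).coeff (k + 1) =
      (shift h p).coeff (k + 1) * X i + (shift h p).coeff k * h i := by
  rw [map_mul]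
  simp [shift, mul_add, ← mul_assoc, Polynomial.coeff_mul_C, Polynomial.coeff_mul_X]

theorem shift_C (h : Fin n → MvPolynomial (Fin n) K) (c : K) :
    shift h (C c) = Polynomial.C (C c) := by
  simp only [shift, aeval_C]; rfl

theorem coeff_zero_shift (h : Fin n → MvPolynomial (Fin n) K) (f : MvPolynomial (Fin n) K) :
    (shift h f).coeff 0 = f := by
  induction f using MvPolynomial.induction_on with
  | C c => rw [shift_C, Polynomial.coeff_C_zero]
  | add p q hp hq => rw [map_add, Polynomial.coeff_add, hp, hq]
  | mul_X p i hp => rw [coeff_shift_mul_X_zero, hp]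

/-- Since `D_h` kills the `h_j`, the substitution is the exponential `f(x + t h) = exp(t D_h) f`;
this is its coefficient recursion, free of division. -/
theorem succ_mul_coeff_shift {h : Fin n → MvPolynomial (Fin n) K} (hself : IsSelfVanishing h)
    (f : MvPolynomial (Fin n) K) (k : ℕ) :
    ((k + 1 : ℕ) : MvPolynomial (Fin n) K) * (shift h f).coeff (k + 1) =
      diffOp h ((shift h f).coeff k) := by
  induction f using MvPolynomial.induction_on generalizing k with
  | C c => cases k <;> simp [Polynomial.coeff_C]
  | add p q hp hq => rw [map_add, Polynomial.coeff_add, Polynomial.coeff_add, diffOp_add, mul_add,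
      hp, hq]
  | mul_X p i hp =>
    have hi : diffOp h (h i) = 0 := hself i
    have h1 := hp k
    cases k with
    | zero =>
      rw [coeff_shift_mul_X_zero, coeff_shift_mul_X_succ, diffOp_mul, diffOp_X, ← h1]
      push_cast
      ring
    | succ k =>
      have h2 := hp k
      rw [coeff_shift_mul_X_succ, coeff_shift_mul_X_succ, diffOp_add, diffOp_mul, diffOp_mul,
        diffOp_X, hi, ← h1, ← h2]
      push_cast
      ring

theorem shift_eq_C [CharZero K] {h : Fin n → MvPolynomial (Fin n) K} (hself : IsSelfVanishing h)
    {f : MvPolynomial (Fin n) K} (hf : diffOp h f = 0) : shift h f = Polynomial.C f := by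
  have key : ∀ k, (shift h f).coeff (k + 1) = 0 := by
    intro k
    have hk : ((k + 1 : ℕ) : MvPolynomial (Fin n) K) ≠ 0 := Nat.cast_ne_zero.mpr k.succ_ne_zero
    have h1 := succ_mul_coeff_shift hself f k
    induction k with
    | zero =>
      rw [coeff_zero_shift, hf] at h1
      exact (mul_eq_zero.mp h1).resolve_left hk
    | succ k ih =>
      rw [ih (Nat.cast_ne_zero.mpr k.succ_ne_zero) (succ_mul_coeff_shift hself f k),
        diffOp_zero] at h1
      exact (mul_eq_zero.mp h1).resolve_left hk
  ext1 k
  cases k with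
  | zero => rw [coeff_zero_shift, Polynomial.coeff_C_zero]
  | succ k => rw [key, Polynomial.coeff_C_succ]

/-- The kernel of `D_x(h)` is factorially closed when `h` is self-vanishing. -/
theorem diffOp_eq_zero_of_mul [CharZero K] {h : Fin n → MvPolynomial (Fin n) K}
    (hself : IsSelfVanishing h) {f g : MvPolynomial (Fin n) K} (hfg : diffOp h (f * g) = 0)
    (hne : f * g ≠ 0) : diffOp h f = 0 := by
  have h1 : shift h f * shift h g = Polynomial.C (f * g) := by
    rw [← map_mul, shift_eq_C hself hfg]
  have hf : shift h f ≠ 0 := fun h0 => hne (by simpa [h0] using h1.symm)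
  have hg : shift h g ≠ 0 := fun h0 => hne (by simpa [h0] using h1.symm)
  -- Degrees in `t` add over a domain, so both factors have degree `0` in `t`; the coefficient of
  -- `t` in `f(x + t h)` is `D_h f`.
  have h2 := congrArg Polynomial.natDegree h1
  rw [Polynomial.natDegree_mul hf hg, Polynomial.natDegree_C] at h2
  have h3 := succ_mul_coeff_shift hself f 0
  rw [coeff_zero_shift, Polynomial.coeff_eq_zero_of_natDegree_lt (by omega), mul_zero] at h3
  exact h3.symm

/-! ### Factors of homogeneous polynomials -/

/-- The substitution `f(x) ↦ f(t x)`. -/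
noncomputable def scale : MvPolynomial (Fin n) K →ₐ[K] Polynomial (MvPolynomial (Fin n) K) :=
  aeval fun i => Polynomial.X * Polynomial.C (X i)

theorem scale_monomial (m : Fin n →₀ ℕ) (c : K) :
    scale (monomial m c) = Polynomial.monomial m.degree (monomial m c) := by
  rw [scale, aeval_monomial, monomial_eq]
  simp only [mul_pow, Finsupp.prod, Finset.prod_mul_distrib, Finset.prod_pow_eq_pow_sum]
  rw [← Polynomial.C_mul_X_pow_eq_monomial]
  simp only [map_mul, map_prod, map_pow, Finsupp.degree_apply]
  rw [show (algebraMap K (Polynomial (MvPolynomial (Fin n) K))) c = Polynomial.C (C c) from rfl]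
  ring

theorem coeff_scale (f : MvPolynomial (Fin n) K) (k : ℕ) :
    (scale f).coeff k = homogeneousComponent k f := by
  induction f using MvPolynomial.induction_on' with
  | monomial m c =>
    rw [scale_monomial, Polynomial.coeff_monomial,
      homogeneousComponent_of_mem (isHomogeneous_monomial c rfl)]
    simp only [eq_comm]
  | add p q hp hq => rw [map_add, Polynomial.coeff_add, hp, hq, map_add]

theorem scale_eq_monomial {f : MvPolynomial (Fin n) K} {d : ℕ} (hf : f.IsHomogeneous d) :
    scale f = Polynomial.monomial d f := by
  ext1 k
  rw [coeff_scale, homogeneousComponent_of_mem hf, Polynomial.coeff_monomial]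
  simp only [eq_comm]

/-- The product `f(tx) g(tx)` is a monomial in `t`. Degree and trailing degree in `t` are both
additive, so they agree on each factor. -/
theorem isHomogeneous_of_mul {f g : MvPolynomial (Fin n) K} {d : ℕ} (hfg : (f * g).IsHomogeneous d)
    (hne : f * g ≠ 0) : f.IsHomogeneous f.totalDegree := by
  have h1 : scale f * scale g = Polynomial.monomial d (f * g) := by
    rw [← map_mul, scale_eq_monomial hfg]
  have hf : scale f ≠ 0 := fun h0 => hne (by simpa [h0] using h1.symm)
  have hg : scale g ≠ 0 := fun h0 => hne (by simpa [h0] using h1.symm)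
  have h2 := congrArg Polynomial.natDegree h1
  have h3 := congrArg Polynomial.natTrailingDegree h1
  rw [Polynomial.natDegree_mul hf hg, Polynomial.natDegree_monomial_eq _ hne] at h2
  rw [Polynomial.natTrailingDegree_mul hf hg, Polynomial.natTrailingDegree_monomial hne] at h3
  have h4 := (scale f).natTrailingDegree_le_natDegree
  have h5 := (scale g).natTrailingDegree_le_natDegree
  set a := (scale f).natDegree with ha
  have hcoeff : ∀ k, k ≠ a → homogeneousComponent k f = 0 := by
    intro k hk
    rw [← coeff_scale]
    rcases lt_or_gt_of_ne hk with hk | hk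
    · exact Polynomial.coeff_eq_zero_of_lt_natTrailingDegree (by omega)
    · exact Polynomial.coeff_eq_zero_of_natDegree_lt hk
  have hfa : f.IsHomogeneous a := by
    have := sum_homogeneousComponent f
    rw [← this]
    refine IsHomogeneous.sum _ _ _ fun k _ => ?_
    by_cases hk : k = a
    · exact hk ▸ homogeneousComponent_isHomogeneous k f
    · rw [hcoeff k hk]; exact isHomogeneous_zero _ _ _
  rwa [hfa.totalDegree (left_ne_zero_of_mul hne)]

/-! ### Irreducible closed sets in dimension one -/

section Topology

open TopologicalSpace

theorem isPreirreducible_preimage_val {X : Type*} [TopologicalSpace X] {W A : Set X}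
    (hA : IsPreirreducible A) (hAW : A ⊆ W) : IsPreirreducible ((↑) ⁻¹' A : Set W) := by
  rintro _ _ ⟨u, hu, rfl⟩ ⟨v, hv, rfl⟩ ⟨x, hxA, hxu⟩ ⟨y, hyA, hyv⟩
  obtain ⟨z, hzA, hzu, hzv⟩ := hA u v hu hv ⟨x, hxA, hxu⟩ ⟨y, hyA, hyv⟩
  exact ⟨⟨z, hAW hzA⟩, hzA, hzu, hzv⟩

/-- In an irreducible closed set of dimension at most one in a `T₁` space, the proper irreducible
closed subsets are points. -/
theorem subsingleton_of_topologicalKrullDim_le_one {X : Type*} [TopologicalSpace X] [T1Space X]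
    {W A : Set X} (hW : IsIrreducible W) (hdim : topologicalKrullDim W ≤ 1)
    (hA : IsIrreducible A) (hAc : IsClosed A) (hAW : A ⊂ W) : A.Subsingleton := by
  intro P hP Q hQ
  by_contra hne
  have hsub := hAW.subset
  let Z : IrreducibleCloseds W :=
    ⟨((↑) : W → X) ⁻¹' A, ⟨⟨(⟨P, hsub hP⟩ : W), hP⟩, isPreirreducible_preimage_val hA.2 hsub⟩,
      hAc.preimage continuous_subtype_val⟩
  let Z0 : IrreducibleCloseds W := ⟨{⟨P, hsub hP⟩}, isIrreducible_singleton, isClosed_singleton⟩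
  let Z1 : IrreducibleCloseds W :=
    ⟨((↑) : W → X) ⁻¹' W, ⟨⟨(⟨P, hsub hP⟩ : W), hsub hP⟩, isPreirreducible_preimage_val hW.2 subset_rfl⟩,
      by rw [Subtype.coe_preimage_self]; exact isClosed_univ⟩
  -- In dimension at most one `A` is minimal or maximal among irreducible closed sets, but it would
  -- lie strictly between `{P}` and `W`.
  rcases Order.krullDim_le_one_iff.mp hdim Z with hmin | hmax
  · have hle : Z0 ≤ Z := by
      rintro _ rfl
      exact hP
    have := hmin hle (show (⟨Q, hsub hQ⟩ : W) ∈ (Z : Set W) from hQ)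
    exact hne (congrArg Subtype.val (Set.mem_singleton_iff.mp this)).symm
  · have hle : Z ≤ Z1 := fun x _ => x.2
    exact hAW.not_subset fun x hx => hmax hle (show (⟨x, hx⟩ : W) ∈ (Z1 : Set W) from hx)

end Topology

/-! ### Zariski closed sets and points of projective space -/

theorem mk_mem_zeroLocus {S : Set (MvPolynomial (Fin n) K)}
    (hS : ∀ f ∈ S, ∃ d, f.IsHomogeneous d) {v : Fin n → K} (hv : v ≠ 0) :
    Projectivization.mk K v hv ∈ zeroLocus S ↔ ∀ f ∈ S, eval v f = 0 := by
  refine forall₂_congr fun f hf => ?_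
  obtain ⟨d, hd⟩ := hS f hf
  rw [Projectivization.submodule_mk]
  refine ⟨fun H => H v (Submodule.mem_span_singleton_self v), fun H w hw => ?_⟩
  obtain ⟨c, rfl⟩ := Submodule.mem_span_singleton.mp hw
  rw [eval_smul_of_homogeneous hd, H, mul_zero]

theorem eval_aeval (h : Fin n → MvPolynomial (Fin n) K) (x : Fin n → K)
    (F : MvPolynomial (Fin n) K) :
    eval x (aeval h F) = eval (fun j => eval x (h j)) F := by
  induction F using MvPolynomial.induction_on with
  | C c => simp
  | add p q hp hq => rw [map_add, map_add, map_add, hp, hq]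
  | mul_X p i hp => rw [map_mul, map_mul, map_mul, hp, aeval_X, eval_X]

attribute [local instance] zariskiTopology

theorem isClosed_iff_isAlgebraic {A : Set (ℙ K (Fin n → K))} : IsClosed A ↔ IsAlgebraic A := by
  rw [← isOpen_compl_iff]
  show IsAlgebraic Aᶜᶜ ↔ _
  rw [compl_compl]

theorem sum_C_mul_X_isHomogeneous (b : Fin n → K) :
    (∑ i, C (b i) * X i : MvPolynomial (Fin n) K).IsHomogeneous 1 :=
  IsHomogeneous.sum _ _ _ fun i _ => (isHomogeneous_X K i).C_mul (b i)

/-- The points of a linear subspace form a Zariski closed set. -/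
theorem isClosed_linear (B : Set (Fin n → K)) :
    IsClosed {P : ℙ K (Fin n → K) | ∀ b ∈ B, ∑ i, b i * P.rep i = 0} := by
  rw [isClosed_iff_isAlgebraic]
  have hhom : ∀ f ∈ (fun b : Fin n → K => ∑ i, C (b i) * X i) '' B,
      ∃ d, (f : MvPolynomial (Fin n) K).IsHomogeneous d := by
    rintro _ ⟨b, -, rfl⟩
    exact ⟨1, sum_C_mul_X_isHomogeneous b⟩
  refine ⟨_, hhom, ?_⟩
  ext P
  rw [← P.mk_rep, mk_mem_zeroLocus hhom, P.mk_rep]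
  simp

theorem mem_linear_iff (b v : Fin n → K) (hv : v ≠ 0) :
    ∑ i, b i * (Projectivization.mk K v hv).rep i = 0 ↔ ∑ i, b i * v i = 0 := by
  obtain ⟨c, hc⟩ := Projectivization.exists_smul_eq_mk_rep K v hv
  rw [← hc]
  simp only [Pi.smul_apply, Units.smul_def, smul_eq_mul, mul_left_comm _ (c : K),
    ← Finset.mul_sum, mul_eq_zero, c.ne_zero, false_or]

instance : T1Space (ℙ K (Fin n → K)) := by
  refine ⟨fun P => ?_⟩
  induction P using Projectivization.ind with
  | h v hv =>
  convert! isClosed_linear {b : Fin n → K | ∑ i, b i * v i = 0} using 1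
  ext Q
  induction Q using Projectivization.ind with
  | h w hw =>
  simp only [Set.mem_singleton_iff, Set.mem_ofPred_eq, mem_linear_iff]
  rw [Projectivization.mk_eq_mk_iff']
  constructor
  · rintro ⟨c, rfl⟩ b hb
    simp [mul_left_comm _ c, ← Finset.mul_sum, hb]
  · intro H
    obtain ⟨i, hi⟩ := Function.ne_iff.mp hv
    refine ⟨w i / v i, funext fun j => ?_⟩
    -- The forms `v_i x_j - v_j x_i`, with `v_i ≠ 0`, cut out the point `v`.
    have := H (Pi.single j (v i) - Pi.single i (v j)) (by
      simp [sub_mul, Finset.sum_sub_distrib, Pi.single_apply, mul_comm (v i)])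
    simp [sub_mul, Finset.sum_sub_distrib, Pi.single_apply, sub_eq_zero] at this
    have hi' : v i ≠ 0 := hi
    simp only [Pi.smul_apply, smul_eq_mul]
    field_simp
    linear_combination -this

/-! ### Values of `h` on irreducible varieties -/

/-- The values `(h_1(x) : ⋯ : h_n(x))` at the points `x` of the affine variety of an ideal. -/
def valuesOn (h : Fin n → MvPolynomial (Fin n) K) (I : Ideal (MvPolynomial (Fin n) K)) :
    Set (ℙ K (Fin n → K)) :=
  {Q | ∃ x : Fin n → K, (∀ f ∈ I, eval x f = 0) ∧
    ∃ hx : (fun j => eval x (h j)) ≠ 0, Q = Projectivization.mk K (fun j => eval x (h j)) hx}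

/-- This is the Nullstellensatz for a prime ideal. -/
theorem exists_eval_ne_zero [IsAlgClosed K] {I : Ideal (MvPolynomial (Fin n) K)} [I.IsPrime]
    {f : MvPolynomial (Fin n) K} (hf : f ∉ I) :
    ∃ x : Fin n → K, (∀ g ∈ I, eval x g = 0) ∧ eval x f ≠ 0 := by
  by_contra! H
  refine hf ?_
  rw [← MvPolynomial.IsPrime.vanishingIdeal_zeroLocus (K := K) I, mem_vanishingIdeal_iff]
  intro x hx
  simpa [aeval_eq_eval] using H x fun g hg => by simpa [aeval_eq_eval] using hx g hg

theorem isIrreducible_valuesOn [IsAlgClosed K] (h : Fin n → MvPolynomial (Fin n) K)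
    (I : Ideal (MvPolynomial (Fin n) K)) [I.IsPrime] {i : Fin n} (hi : h i ∉ I) :
    IsIrreducible (valuesOn h I) := by
  constructor
  · obtain ⟨x, hxI, hx⟩ := exists_eval_ne_zero hi
    exact ⟨_, x, hxI, fun h0 => hx (congrFun h0 i), rfl⟩
  rw [isPreirreducible_iff_isClosed_union_isClosed]
  intro A B hA hB hAB
  rw [isClosed_iff_isAlgebraic] at hA hB
  obtain ⟨S, hS, rfl⟩ := hA
  obtain ⟨S', hS', rfl⟩ := hB
  have key : ∀ S : Set (MvPolynomial (Fin n) K), (∀ f ∈ S, ∃ d, f.IsHomogeneous d) →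
      ¬ valuesOn h I ⊆ zeroLocus S → ∃ F ∈ S, aeval h F ∉ I := by
    intro S hS hnot
    obtain ⟨_, ⟨x, hxI, hx, rfl⟩, hxS⟩ := Set.not_subset.mp hnot
    rw [mk_mem_zeroLocus hS] at hxS
    push Not at hxS
    obtain ⟨F, hF, hFx⟩ := hxS
    exact ⟨F, hF, fun hmem => hFx (by rw [← eval_aeval]; exact hxI _ hmem)⟩
  by_contra! hcon
  obtain ⟨F, hF, hFI⟩ := key S hS hcon.1
  obtain ⟨G, hG, hGI⟩ := key S' hS' hcon.2
  have hprime : I.IsPrime := inferInstance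
  -- The extra factor `h i` ensures that `h` defines a point at `x`.
  obtain ⟨x, hxI, hx⟩ := exists_eval_ne_zero
    (hprime.mul_notMem (hprime.mul_notMem hFI hGI) hi)
  simp only [map_mul, mul_ne_zero_iff, eval_aeval] at hx
  have hx0 : (fun j => eval x (h j)) ≠ 0 := fun h0 => hx.2 (congrFun h0 i)
  rcases hAB ⟨x, hxI, hx0, rfl⟩ with hm | hm
  · exact hx.1.1 ((mk_mem_zeroLocus hS hx0).mp hm F hF)
  · exact hx.1.2 ((mk_mem_zeroLocus hS' hx0).mp hm G hG)

theorem valuesOn_subset_valueSet {h : Fin n → MvPolynomial (Fin n) K} {d : ℕ}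
    (hd : ∀ j, (h j).IsHomogeneous d) (hd0 : d ≠ 0) (I : Ideal (MvPolynomial (Fin n) K)) :
    valuesOn h I ⊆ valueSet h := by
  rintro _ ⟨x, -, hx, rfl⟩
  refine ⟨x, ?_, hx, rfl⟩
  rintro rfl
  refine hx (funext fun j => ?_)
  have := eval_smul_of_homogeneous (hd j) (0 : K) 0
  simpa [hd0] using this

theorem valueSet_subset_valuesOn_bot (h : Fin n → MvPolynomial (Fin n) K) :
    valueSet h ⊆ valuesOn h ⊥ := by
  rintro _ ⟨x, -, hx, rfl⟩
  exact ⟨x, by simp, hx, rfl⟩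

theorem valueSet_subset_image (h : Fin n → MvPolynomial (Fin n) K) : valueSet h ⊆ image h :=
  subset_closure

theorem isClosed_image (h : Fin n → MvPolynomial (Fin n) K) : IsClosed (image h) :=
  isClosed_closure

theorem image_subset_iff {h : Fin n → MvPolynomial (Fin n) K} {A : Set (ℙ K (Fin n → K))}
    (hA : IsClosed A) : image h ⊆ A ↔ valueSet h ⊆ A :=
  hA.closure_subset_iff

theorem image_subset_linear_iff [IsAlgClosed K] {h : Fin n → MvPolynomial (Fin n) K} {d : ℕ}
    (hd : ∀ j, (h j).IsHomogeneous d) (hd0 : d ≠ 0) (B : Set (Fin n → K)) :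
    image h ⊆ {P : ℙ K (Fin n → K) | ∀ b ∈ B, ∑ i, b i * P.rep i = 0} ↔
      ∀ b ∈ B, ∑ i, C (b i) * h i = 0 := by
  rw [image_subset_iff (isClosed_linear B)]
  constructor
  · intro H b hb
    by_contra hne
    obtain ⟨x, -, hx⟩ := exists_eval_ne_zero (I := ⊥) (by rwa [Ideal.mem_bot])
    simp only [map_sum, map_mul, eval_C] at hx
    have hx0 : (fun j => eval x (h j)) ≠ 0 := by
      intro h0
      exact hx (Finset.sum_eq_zero fun i _ => by rw [show eval x (h i) = 0 from congrFun h0 i,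
        mul_zero])
    exact hx ((mem_linear_iff _ _ hx0).mp
      (H (valuesOn_subset_valueSet hd hd0 ⊥ ⟨x, by simp, hx0, rfl⟩) b hb))
  · rintro H _ ⟨x, -, hx, rfl⟩ b hb
    rw [mem_linear_iff]
    simpa using congrArg (eval x) (H b hb)

theorem degree_ne_zero {h : Fin n → MvPolynomial (Fin n) K} {d : ℕ}
    (hd : ∀ j, (h j).IsHomogeneous d) (hdim : dimension (image h) = 1) : d ≠ 0 := by
  rintro rfl
  have hsub : (valueSet h).Subsingleton := by
    rintro _ ⟨x, -, hx, rfl⟩ _ ⟨y, -, hy, rfl⟩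
    congr 1
    funext j
    have hj := totalDegree_eq_zero_iff_eq_C.mp (Nat.le_zero.mp (hd j).totalDegree_le)
    rw [hj, eval_C, eval_C]
  have himg : (image h).Subsingleton := hsub.closure
  have : Subsingleton (image h) := himg.coe_sort
  have hle := topologicalKrullDim_zero_of_discreteTopology (image h)
  have h1 : topologicalKrullDim (image h) = 1 := hdim
  rw [h1] at hle
  exact absurd hle (by decide)

/-- If `u` is an irreducible factor of a linear combination of the `h_j`, then `h` takes a single
value `ω` on the zero set of `u`. -/
theorem exists_direction [IsAlgClosed K] {h : Fin n → MvPolynomial (Fin n) K} {d : ℕ}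
    (hd : ∀ j, (h j).IsHomogeneous d) (hdim : dimension (image h) = 1)
    {u : MvPolynomial (Fin n) K} (hu : Prime u) {i : Fin n} (hi : ¬ u ∣ h i)
    {a : Fin n → K} (ha : ∑ i, C (a i) * h i ≠ 0) (hua : u ∣ ∑ i, C (a i) * h i) :
    ∃ ω : Fin n → K, ∀ j, u ∣ h j - C (ω j) * h i := by
  have hd0 := degree_ne_zero hd hdim
  have hI : (Ideal.span {u}).IsPrime := (Ideal.span_singleton_prime hu.ne_zero).mpr hu
  have hiI : h i ∉ Ideal.span {u} := by rwa [Ideal.mem_span_singleton]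
  have hirr := isIrreducible_valuesOn h (Ideal.span {u}) hiI
  have hbot : h i ∉ (⊥ : Ideal (MvPolynomial (Fin n) K)) := by
    rw [Ideal.mem_bot]
    exact fun h0 => hi (h0 ▸ dvd_zero u)
  have hW : IsIrreducible (image h) := by
    have : valueSet h = valuesOn h ⊥ :=
      (valueSet_subset_valuesOn_bot h).antisymm (valuesOn_subset_valueSet hd hd0 ⊥)
    exact IsIrreducible.closure (this ▸ isIrreducible_valuesOn h ⊥ hbot)
  have hsubW : closure (valuesOn h (Ideal.span {u})) ⊆ image h :=
    closure_mono (valuesOn_subset_valueSet hd hd0 _)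
  have hlin : closure (valuesOn h (Ideal.span {u})) ⊆
      {P : ℙ K (Fin n → K) | ∀ b ∈ ({a} : Set (Fin n → K)), ∑ i, b i * P.rep i = 0} := by
    refine (isClosed_linear {a}).closure_subset_iff.mpr ?_
    rintro _ ⟨x, hxI, hx, rfl⟩ b rfl
    rw [mem_linear_iff]
    simpa using hxI _ (Ideal.mem_span_singleton.mpr hua)
  -- The inclusion is strict: otherwise `W` would lie in the hyperplane of `a`, making `∑ a_i h_i`
  -- zero.
  have hss : closure (valuesOn h (Ideal.span {u})) ⊂ image h := by
    refine hsubW.ssubset_of_not_subset fun H => ha ?_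
    exact (image_subset_linear_iff hd hd0 {a}).mp (H.trans hlin) a rfl
  have hsing := subsingleton_of_topologicalKrullDim_le_one hW
    (show topologicalKrullDim (image h) ≤ 1 from le_of_eq hdim) hirr.closure isClosed_closure hss
  obtain ⟨x, hxI, hx⟩ := exists_eval_ne_zero hiI
  have hx0 : (fun j => eval x (h j)) ≠ 0 := fun h0 => hx (congrFun h0 i)
  -- The single value is normalised to have `i`-th coordinate `1`. Divisibility by `u` is then
  -- tested on the zeros of `u`, including those where all of `h` vanishes.
  refine ⟨fun j => eval x (h j) / eval x (h i), fun j => ?_⟩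
  rw [← Ideal.mem_span_singleton]
  by_contra hj
  obtain ⟨y, hyI, hy⟩ := exists_eval_ne_zero hj
  by_cases hy0 : (fun j => eval y (h j)) = 0
  · have h1 : eval y (h j) = 0 := congrFun hy0 j
    have h2 : eval y (h i) = 0 := congrFun hy0 i
    exact hy (by simp [h1, h2])
  have heq := hsing (subset_closure ⟨y, hyI, hy0, rfl⟩) (subset_closure ⟨x, hxI, hx0, rfl⟩)
  rw [Projectivization.mk_eq_mk_iff'] at heq
  obtain ⟨c, hc⟩ := heq
  have h1 : c * eval x (h j) = eval y (h j) := congrFun hc j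
  have h2 : c * eval x (h i) = eval y (h i) := congrFun hc i
  refine hy ?_
  simp only [map_sub, map_mul, eval_C, ← h1, ← h2]
  field_simp
  ring

/-! ### Invariance of the image under common factors -/

/-- Multiplying `h` by a common factor does not change the image. -/
theorem image_subset_image_mul [IsAlgClosed K] {h h' : Fin n → MvPolynomial (Fin n) K} {d : ℕ}
    (hd : ∀ j, (h j).IsHomogeneous d) (hd0 : d ≠ 0) {g : MvPolynomial (Fin n) K} (hg : g ≠ 0)
    (hgh : ∀ j, h j = g * h' j) : image h' ⊆ image h := by
  rw [image_subset_iff (isClosed_image h)]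
  rintro _ ⟨x, -, hx, rfl⟩
  obtain ⟨S, hS, hWS⟩ := isClosed_iff_isAlgebraic.mp (isClosed_image h)
  rw [hWS, mk_mem_zeroLocus hS]
  by_contra! hcon
  obtain ⟨F, hF, hFx⟩ := hcon
  obtain ⟨i, hi⟩ := Function.ne_iff.mp hx
  -- Values of `h'` at zeros of `g` are not directly values of `h`. A form not vanishing at such a
  -- value is also nonzero at some `h'(y)` with `g(y) ≠ 0`.
  have hne : aeval h' F * h' i * g ≠ 0 := by
    refine mul_ne_zero (mul_ne_zero ?_ ?_) hg <;> intro h0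
    · exact hFx (by rw [← eval_aeval, h0, map_zero])
    · exact hi (by simp [h0])
  obtain ⟨y, -, hy⟩ := exists_eval_ne_zero (I := ⊥) (by rwa [Ideal.mem_bot])
  simp only [map_mul, mul_ne_zero_iff, eval_aeval] at hy
  have hy' : (fun j => eval y (h' j)) ≠ 0 := fun h0 => hy.1.2 (congrFun h0 i)
  have hyh : (fun j => eval y (h j)) = eval y g • fun j => eval y (h' j) := by
    funext j
    simp [hgh]
  have hy0 : (fun j => eval y (h j)) ≠ 0 := by
    rw [hyh]
    exact smul_ne_zero hy.2 hy'
  have hmem := valueSet_subset_image h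
    (valuesOn_subset_valueSet hd hd0 ⊥ ⟨y, by simp, hy0, rfl⟩)
  rw [(Projectivization.mk_eq_mk_iff' K _ _ hy0 hy').mpr ⟨eval y g, hyh.symm⟩, hWS,
    mk_mem_zeroLocus hS] at hmem
  exact hy.1.1 (hmem F hF)

theorem image_mul [IsAlgClosed K] {h h' : Fin n → MvPolynomial (Fin n) K} {d : ℕ}
    (hd : ∀ j, (h j).IsHomogeneous d) (hd0 : d ≠ 0) {g : MvPolynomial (Fin n) K} (hg : g ≠ 0)
    (hgh : ∀ j, h j = g * h' j) : image h = image h' := by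
  refine ((image_subset_iff (isClosed_image h')).mpr ?_).antisymm
    (image_subset_image_mul hd hd0 hg hgh)
  rintro _ ⟨x, hx0, hx, rfl⟩
  have hxh : (fun j => eval x (h j)) = eval x g • fun j => eval x (h' j) := by
    funext j
    simp [hgh]
  have hx' : (fun j => eval x (h' j)) ≠ 0 := fun h0 => hx (by rw [hxh, h0, smul_zero])
  exact valueSet_subset_image h' ⟨x, hx0, hx', (Projectivization.mk_eq_mk_iff' K _ _ hx hx').mpr
    ⟨eval x g, hxh.symm⟩⟩

/-! ### Directions attached to irreducible factors -/

/-- The derivative of `f` along the constant vector `ω`. -/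
noncomputable abbrev dirDeriv (ω : Fin n → K) (f : MvPolynomial (Fin n) K) :
    MvPolynomial (Fin n) K :=
  diffOp (fun j => C (ω j)) f

theorem dirDeriv_isHomogeneous (ω : Fin n → K) {f : MvPolynomial (Fin n) K} {d : ℕ}
    (hf : f.IsHomogeneous d) : (dirDeriv ω f).IsHomogeneous (d - 1) :=
  IsHomogeneous.sum _ _ _ fun _ _ => hf.pderiv.C_mul _

theorem dirDeriv_eq_zero_of_dvd (ω : Fin n → K) {u v : MvPolynomial (Fin n) K}
    (hv : v.IsHomogeneous v.totalDegree) (hle : v.totalDegree ≤ u.totalDegree)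
    (hdvd : u ∣ dirDeriv ω v) : dirDeriv ω v = 0 := by
  by_contra hne
  have h1 := totalDegree_le_of_dvd_of_isDomain hdvd hne
  rw [(dirDeriv_isHomogeneous ω hv).totalDegree hne] at h1
  -- Here `deg v ≤ deg u ≤ deg v - 1` with truncated subtraction, leaving only constant `v`.
  have h2 : v.totalDegree = 0 := by omega
  rw [totalDegree_eq_zero_iff_eq_C.mp h2] at hne
  exact hne (diffOp_C _ _)

theorem diffOp_eq_zero_of_irreducible_factors (g : Fin n → MvPolynomial (Fin n) K)
    (f : MvPolynomial (Fin n) K) (hf : ∀ u, Irreducible u → u ∣ f → diffOp g u = 0) :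
    diffOp g f = 0 := by
  induction f using WfDvdMonoid.induction_on_irreducible with
  | zero => exact diffOp_zero g
  | unit u hu =>
    obtain ⟨c, -, rfl⟩ := MvPolynomial.isUnit_iff_eq_C_of_isReduced.mp hu
    exact diffOp_C g c
  | mul a i _ hi ih =>
    rw [diffOp_mul, hf i hi (dvd_mul_right _ _),
      ih fun u hu hua => hf u hu (hua.mul_left i)]
    ring

/-- The vectors `ω` with `∑ k, ω_k ∂h_j/∂x_k = 0` for all `j`. -/
def killingSubmodule (h : Fin n → MvPolynomial (Fin n) K) : Submodule K (Fin n → K) where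
  carrier := {ω | ∀ j, dirDeriv ω (h j) = 0}
  add_mem' {a b} ha hb j := by
    have h1 := ha j
    have h2 := hb j
    simp only [dirDeriv, diffOp] at h1 h2 ⊢
    simp only [Pi.add_apply, C_add, add_mul, Finset.sum_add_distrib, h1, h2, add_zero]
  zero_mem' j := by simp [dirDeriv, diffOp]
  smul_mem' c a ha j := by
    have h1 := ha j
    simp only [dirDeriv, diffOp] at h1 ⊢
    simp only [Pi.smul_apply, smul_eq_mul, C_mul, mul_assoc, ← Finset.mul_sum, h1, mul_zero]

/-- `h` is congruent modulo `u` to a nonzero multiple of the constant vector `ω`. -/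
def IsDirection (h : Fin n → MvPolynomial (Fin n) K) (u : MvPolynomial (Fin n) K)
    (ω : Fin n → K) : Prop :=
  ω ≠ 0 ∧ ∃ i, ¬ u ∣ h i ∧ ∀ j, u ∣ h j - C (ω j) * h i

theorem exists_isDirection [IsAlgClosed K] {h : Fin n → MvPolynomial (Fin n) K} {d : ℕ}
    (hd : ∀ j, (h j).IsHomogeneous d) (hdim : dimension (image h) = 1) (hgcd : HasTrivialGCD h)
    {u : MvPolynomial (Fin n) K} (hu : Irreducible u) {a : Fin n → K}
    (ha : ∑ i, C (a i) * h i ≠ 0) (hua : u ∣ ∑ i, C (a i) * h i) :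
    ∃ ω, IsDirection h u ω := by
  obtain ⟨i, hi⟩ : ∃ i, ¬ u ∣ h i := by
    by_contra! H
    exact hu.not_isUnit (hgcd u H)
  obtain ⟨ω, hω⟩ := exists_direction hd hdim hu.prime hi ha hua
  refine ⟨ω, ?_, i, hi, hω⟩
  rintro rfl
  exact hi (by simpa using hω i)

theorem IsDirection.dvd_sum_iff {h : Fin n → MvPolynomial (Fin n) K}
    {u : MvPolynomial (Fin n) K} {ω : Fin n → K} (hω : IsDirection h u ω) (hu : Prime u)
    (a : Fin n → K) : u ∣ ∑ i, C (a i) * h i ↔ ∑ i, a i * ω i = 0 := by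
  obtain ⟨-, i, hi, hω⟩ := hω
  have h1 : u ∣ ∑ j, C (a j) * h j - C (∑ j, a j * ω j) * h i := by
    have : ∑ j, C (a j) * h j - C (∑ j, a j * ω j) * h i =
        ∑ j, C (a j) * (h j - C (ω j) * h i) := by
      simp only [mul_sub, Finset.sum_sub_distrib, map_sum, Finset.sum_mul, C_mul, mul_assoc]
    rw [this]
    exact Finset.dvd_sum fun j _ => (hω j).mul_left _
  constructor
  · intro H
    by_contra hne
    rcases hu.dvd_or_dvd ((dvd_sub_right H).mp h1) with h2 | h2
    · exact hu.not_isUnit (isUnit_of_dvd_unit h2 ((isUnit_iff_ne_zero.mpr hne).map C))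
    · exact hi h2
  · intro H
    simpa [H] using h1

/-- Modulo `u`, the operator `D_h` is `h_i D_ω`, and the prime `u` does not divide `h_i`. -/
theorem IsDirection.dvd_dirDeriv {h : Fin n → MvPolynomial (Fin n) K}
    {u : MvPolynomial (Fin n) K} {ω : Fin n → K} (hω : IsDirection h u ω) (hu : Prime u)
    {v : MvPolynomial (Fin n) K} (hv : diffOp h v = 0) : u ∣ dirDeriv ω v := by
  obtain ⟨-, i, hi, hω⟩ := hω
  have h1 : u ∣ h i * dirDeriv ω v := by
    have : h i * dirDeriv ω v = diffOp h v - ∑ j, (h j - C (ω j) * h i) * pderiv j v := by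
      simp only [dirDeriv, diffOp, sub_mul, Finset.sum_sub_distrib, sub_sub_cancel, Finset.mul_sum]
      exact Finset.sum_congr rfl fun j _ => by ring
    rw [this, hv, zero_sub, dvd_neg]
    exact Finset.dvd_sum fun j _ => (hω j).mul_right _
  exact (hu.dvd_or_dvd h1).resolve_left hi

/-! ### The image lies in the space of annihilating vectors -/

/-- A proper subspace and finitely many hyperplanes do not cover a vector space over an infinite
field. -/
theorem exists_avoiding [Infinite K] (F : Finset (Fin n → K)) (hF : ∀ ω ∈ F, ω ≠ 0)
    {N : Submodule K (Fin n → K)} (hN : N ≠ ⊤) :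
    ∃ a : Fin n → K, (∀ ω ∈ F, ∑ i, a i * ω i ≠ 0) ∧ a ∉ N := by
  classical
  let H : (Fin n → K) → Submodule K (Fin n → K) := fun ω =>
    LinearMap.ker (Fintype.linearCombination K ω)
  have hH : ∀ ω a, a ∈ H ω ↔ ∑ i, a i * ω i = 0 := fun ω a => by
    simp [H, Fintype.linearCombination_apply]
  have hne := Subspace.biUnion_ne_univ_of_top_notMem (s := insert N (F.image H)) (by
    rw [Finset.mem_insert, not_or]
    refine ⟨hN.symm, fun htop => ?_⟩
    obtain ⟨ω, hω, htop⟩ := Finset.mem_image.mp htop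
    refine hF ω hω (funext fun i => ?_)
    simpa [Pi.single_apply] using (hH ω (Pi.single i 1)).mp (htop ▸ Submodule.mem_top))
  obtain ⟨a, ha⟩ := (Set.ne_univ_iff_exists_notMem _).mp hne
  simp only [Set.mem_iUnion, not_exists] at ha
  refine ⟨a, fun ω hω h0 => ?_, ha N (Finset.mem_insert_self _ _)⟩
  exact ha (H ω) (Finset.mem_insert_of_mem (Finset.mem_image_of_mem _ hω)) ((hH ω a).mpr h0)

theorem mem_ker_linearCombination_iff (f : Fin n → MvPolynomial (Fin n) K) (a : Fin n → K) :
    a ∈ LinearMap.ker (Fintype.linearCombination K f) ↔ ∑ i, C (a i) * f i = 0 := by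
  simp [Fintype.linearCombination_apply, smul_eq_C_mul]

theorem ker_linearCombination_ne_top {f : Fin n → MvPolynomial (Fin n) K} (hf : f ≠ 0) :
    LinearMap.ker (Fintype.linearCombination K f) ≠ ⊤ := by
  intro htop
  refine hf (funext fun i => ?_)
  have h1 : Pi.single i 1 ∈ LinearMap.ker (Fintype.linearCombination K f) :=
    htop ▸ Submodule.mem_top
  simpa using h1

/-- Every linear form vanishing on the vectors that annihilate `h` also vanishes on the values
of `h`. -/
theorem sum_eq_zero_of_forall_killingSubmodule [IsAlgClosed K] [CharZero K]
    {h : Fin n → MvPolynomial (Fin n) K} {d : ℕ} (hne : h ≠ 0)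
    (hd : ∀ j, (h j).IsHomogeneous d) (hself : IsSelfVanishing h)
    (hdim : dimension (image h) = 1) (hgcd : HasTrivialGCD h) {b : Fin n → K}
    (hb : ∀ ω ∈ killingSubmodule h, ∑ i, b i * ω i = 0) : ∑ i, C (b i) * h i = 0 := by
  classical
  have hd0 := degree_ne_zero hd hdim
  have hlin : ∀ a : Fin n → K, (∑ i, C (a i) * h i).IsHomogeneous d := fun a =>
    IsHomogeneous.sum _ _ _ fun i _ => (hd i).C_mul _
  -- `Good e` bounds by `e - 1` the degrees of irreducible factors of `h_a` for `a` off finitely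
  -- many hyperplanes. The least such `e` is used below.
  let Good : ℕ → Prop := fun e => ∃ F : Finset (Fin n → K), (∀ ω ∈ F, ω ≠ 0) ∧
    ∀ a : Fin n → K, (∀ ω ∈ F, ∑ i, a i * ω i ≠ 0) → ∑ i, C (a i) * h i ≠ 0 →
      ∀ u, Irreducible u → u ∣ ∑ i, C (a i) * h i → u.totalDegree < e
  have hex : ∃ e, Good e := by
    refine ⟨d + 1, ∅, by simp, fun a _ ha u _ hua => ?_⟩
    exact Nat.lt_succ_of_le ((totalDegree_le_of_dvd_of_isDomain hua ha).trans
      (hlin a).totalDegree_le)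
  obtain ⟨F, hF0, hF⟩ := Nat.find_spec hex
  have hmin : ∀ m < Nat.find hex, ¬ Good m := fun m hm => Nat.find_min hex hm
  set e := Nat.find hex
  have hepos : e ≠ 0 := by
    intro he
    obtain ⟨a, haF, ha⟩ := exists_avoiding F hF0 (ker_linearCombination_ne_top hne)
    rw [mem_ker_linearCombination_iff] at ha
    have hnu : ¬ IsUnit (∑ i, C (a i) * h i) := by
      intro hu
      obtain ⟨c, -, hc⟩ := MvPolynomial.isUnit_iff_eq_C_of_isReduced.mp hu
      have := (hlin a).totalDegree ha
      rw [hc, totalDegree_C] at this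
      exact hd0 this.symm
    obtain ⟨u, hu, hua⟩ := WfDvdMonoid.exists_irreducible_factor hnu ha
    have := hF a haF ha u hu hua
    omega
  have hkill : ∀ u ω, Irreducible u → IsDirection h u ω → e ≤ u.totalDegree + 1 →
      ω ∈ killingSubmodule h := by
    intro u ω hu hω hdeg
    by_contra hmem
    have hne' : (fun i => dirDeriv ω (h i)) ≠ 0 := fun h0 => hmem fun j => congrFun h0 j
    obtain ⟨a, haF, ha⟩ := exists_avoiding F hF0 (ker_linearCombination_ne_top hne')
    rw [mem_ker_linearCombination_iff, ← diffOp_sum_C_mul] at ha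
    -- By the Leibniz rule it suffices that `D_ω` kills each irreducible factor `v` of `h_a`;
    -- genericity of `a` gives `deg v ≤ e - 1 ≤ deg u`.
    refine ha (diffOp_eq_zero_of_irreducible_factors _ _ fun v hv hva => ?_)
    have ha0 : ∑ i, C (a i) * h i ≠ 0 := fun h0 => ha (by rw [h0, diffOp_zero])
    have hvdeg := hF a haF ha0 v hv hva
    have hDa : diffOp h (∑ i, C (a i) * h i) = 0 := by
      rw [diffOp_sum_C_mul]
      exact Finset.sum_eq_zero fun i _ => by rw [show diffOp h (h i) = 0 from hself i, mul_zero]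
    have hahom := hlin a
    obtain ⟨w, hw⟩ := hva
    rw [hw] at hDa ha0 hahom
    exact dirDeriv_eq_zero_of_dvd ω (isHomogeneous_of_mul hahom ha0) (by omega)
      (hω.dvd_dirDeriv hu.prime (diffOp_eq_zero_of_mul hself hDa ha0))
  by_contra hb0
  have hfac : ∀ q ∈ UniqueFactorizationMonoid.factors (∑ i, C (b i) * h i),
      ∃ ω, IsDirection h q ω := fun q hq =>
    exists_isDirection hd hdim hgcd (UniqueFactorizationMonoid.irreducible_of_factor q hq) hb0
      (UniqueFactorizationMonoid.dvd_of_mem_factors hq)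
  choose! Ω hΩ using hfac
  -- Avoiding the hyperplanes orthogonal to the directions of the factors of `h_b` excludes common
  -- factors with `h_b`, and this alone yields `Good (e - 1)`.
  refine hmin (e - 1) (by omega)
    ⟨(UniqueFactorizationMonoid.factors (∑ i, C (b i) * h i)).toFinset.image Ω, ?_, ?_⟩
  · intro ω hω
    obtain ⟨q, hq, rfl⟩ := Finset.mem_image.mp hω
    exact (hΩ q (Multiset.mem_toFinset.mp hq)).1
  · intro a haF ha u hu hua
    by_contra! hdeg
    obtain ⟨ω, hω⟩ := exists_isDirection hd hdim hgcd hu ha hua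
    have hub := (hω.dvd_sum_iff hu.prime b).mpr (hb ω (hkill u ω hu hω (by omega)))
    obtain ⟨q, hq, hassoc⟩ := UniqueFactorizationMonoid.exists_mem_factors_of_dvd hb0 hu hub
    refine haF (Ω q) (Finset.mem_image_of_mem _ (Multiset.mem_toFinset.mpr hq)) ?_
    rw [← (hΩ q hq).dvd_sum_iff (UniqueFactorizationMonoid.prime_of_factor q hq)]
    exact hassoc.dvd_iff_dvd_left.mp hua

theorem linearClosure_image_subset [IsAlgClosed K] [CharZero K]
    {h : Fin n → MvPolynomial (Fin n) K} {d : ℕ} (hne : h ≠ 0)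
    (hd : ∀ j, (h j).IsHomogeneous d) (hself : IsSelfVanishing h)
    (hdim : dimension (image h) = 1) (hgcd : HasTrivialGCD h) :
    linearClosure (image h) ⊆ (killingSubmodule h).projectivization := by
  refine Projectivization.Subspace.span_le_subspace_iff.mpr fun P hP => ?_
  have hsub := (image_subset_linear_iff hd (degree_ne_zero hd hdim)
    {b | ∀ ω ∈ killingSubmodule h, ∑ i, b i * ω i = 0}).mpr fun b hb =>
      sum_eq_zero_of_forall_killingSubmodule hne hd hself hdim hgcd hb
  have hPb := hsub hP
  rw [← P.mk_rep]
  show P.rep ∈ killingSubmodule h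
  by_contra hmem
  -- A vector outside the subspace is separated from it by a linear form, whose coefficients serve
  -- as `b`.
  obtain ⟨φ, hφ, hle⟩ := Submodule.exists_le_ker_of_notMem hmem
  have hφsum : ∀ v : Fin n → K, ∑ i, φ (Pi.single i 1) * v i = φ v := by
    intro v
    conv_rhs => rw [← Finset.univ_sum_single v]
    rw [map_sum]
    refine Finset.sum_congr rfl fun i _ => ?_
    rw [show (Pi.single i (v i) : Fin n → K) = v i • Pi.single i 1 by
      rw [← Pi.single_smul, smul_eq_mul, mul_one], map_smul, smul_eq_mul, mul_comm]
  exact hφ (by rw [← hφsum]; exact hPb _ fun ω hω => by rw [hφsum]; exact hle hω)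

/-! ### Removing the gcd, and vanishing on the linear span -/

/-- Self-vanishing survives division by the gcd `g`: the factor `h'_j` of `h_j` is killed by `D_h =
g D_{h'}`. -/
theorem exists_reduced [CharZero K] {h : Fin n → MvPolynomial (Fin n) K} {d : ℕ} (hne : h ≠ 0)
    (hd : ∀ j, (h j).IsHomogeneous d) (hself : IsSelfVanishing h) :
    ∃ (g : MvPolynomial (Fin n) K) (h' : Fin n → MvPolynomial (Fin n) K) (d' : ℕ), g ≠ 0 ∧
      h' ≠ 0 ∧ (∀ j, h j = g * h' j) ∧ (∀ j, (h' j).IsHomogeneous d') ∧ IsSelfVanishing h' ∧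
      HasTrivialGCD h' := by
  classical
  let := UniqueFactorizationMonoid.strongNormalizationMonoid (α := MvPolynomial (Fin n) K)
  let := UniqueFactorizationMonoid.toNormalizedGCDMonoid (MvPolynomial (Fin n) K)
  obtain ⟨i, hi⟩ := Function.ne_iff.mp hne
  obtain ⟨h', hgh, hgcd⟩ := Finset.extract_gcd (s := Finset.univ) h ⟨i, Finset.mem_univ i⟩
  set g := Finset.univ.gcd h
  replace hgh : ∀ j, h j = g * h' j := fun j => hgh j (Finset.mem_univ j)
  have hg : g ≠ 0 := fun h0 => hi (by rw [hgh, h0, zero_mul]; rfl)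
  have hj0 : ∀ j, h' j ≠ 0 → g * h' j ≠ 0 := fun j hj => mul_ne_zero hg hj
  have hD : ∀ j, h' j ≠ 0 → diffOp h (h' j) = 0 := fun j hj => by
    have h1 : diffOp h (h j) = 0 := hself j
    rw [hgh j, mul_comm] at h1
    exact diffOp_eq_zero_of_mul hself h1 (mul_comm g _ ▸ hj0 j hj)
  refine ⟨g, h', d - g.totalDegree, hg, ?_, hgh, fun j => ?_, fun j => ?_, fun q hq => ?_⟩
  · rintro rfl
    exact hi (by rw [hgh]; simp)
  · by_cases hj : h' j = 0
    · rw [hj]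
      exact isHomogeneous_zero _ _ _
    have hhom := hd j
    rw [hgh j] at hhom
    have h1 := hhom.totalDegree (hj0 j hj)
    rw [totalDegree_mul_of_isDomain hg hj] at h1
    rw [mul_comm] at hhom
    have h2 := isHomogeneous_of_mul hhom (mul_comm g _ ▸ hj0 j hj)
    rwa [show (h' j).totalDegree = d - g.totalDegree by omega] at h2
  · show diffOp h' (h' j) = 0
    by_cases hj : h' j = 0
    · rw [hj, diffOp_zero]
    have h1 : g * diffOp h' (h' j) = 0 := by
      rw [← hD j hj]
      simp only [diffOp, hgh, Finset.mul_sum, mul_assoc]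
    exact (mul_eq_zero.mp h1).resolve_left hg
  · exact isUnit_of_dvd_one (hgcd ▸ Finset.dvd_gcd fun j _ => hq j)

/-- Euler's identity evaluated at `ω` reads `(D_ω f)(ω) = d f(ω)`. -/
theorem eval_eq_zero_of_dirDeriv_eq_zero [CharZero K] {f : MvPolynomial (Fin n) K} {d : ℕ}
    (hf : f.IsHomogeneous d) (hd : d ≠ 0) {ω : Fin n → K} (hω : dirDeriv ω f = 0) :
    eval ω f = 0 := by
  have h1 := congrArg (eval ω) hf.sum_X_mul_pderiv
  have h2 := congrArg (eval ω) hω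
  simp only [dirDeriv, diffOp, map_sum, map_mul, eval_X, eval_C, map_zero] at h1 h2
  rw [h2, map_nsmul, nsmul_eq_mul] at h1
  exact (mul_eq_zero.mp h1.symm).resolve_left (Nat.cast_ne_zero.mpr hd)

end GordanNoether

theorem mainTheorem7 {K : Type*} [Field K] [IsAlgClosed K] [CharZero K] {n : ℕ}
    (h : Fin n → MvPolynomial (Fin n) K)
    (hform : GordanNoether.IsFormSystem h)
    (hself : GordanNoether.IsSelfVanishing h)
    (hdim : GordanNoether.dimension (GordanNoether.image h) = 1) :
    (GordanNoether.HasTrivialGCD h →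
      ∀ j, h j ∈ GordanNoether.solPoints
        (GordanNoether.linearClosure (GordanNoether.image h))) ∧
    GordanNoether.linearClosure (GordanNoether.image h) ⊆ GordanNoether.fundamentalLocus h := by
  obtain ⟨hne, d, hd⟩ := hform
  constructor
  · intro hgcd j P hP ω hω
    exact (Submodule.mem_projectivization_iff_submodule_le _ P).mp
      (GordanNoether.linearClosure_image_subset hne hd hself hdim hgcd hP) hω j
  · obtain ⟨g, h', d', hg, hne', hgh, hd', hself', hgcd'⟩ :=
      GordanNoether.exists_reduced hne hd hself
    have himage := GordanNoether.image_mul hd (GordanNoether.degree_ne_zero hd hdim) hg hgh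
    rw [himage] at hdim ⊢
    rintro P hP _ ⟨j, rfl⟩ ω hω
    have hmem := (Submodule.mem_projectivization_iff_submodule_le _ P).mp
      (GordanNoether.linearClosure_image_subset hne' hd' hself' hdim hgcd' hP) hω j
    rw [hgh, map_mul, GordanNoether.eval_eq_zero_of_dirDeriv_eq_zero (hd' j)
      (GordanNoether.degree_ne_zero hd' hdim) hmem, mul_zero]
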